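/- Let $T$ be an arbitrary set. A simple max-stable process on $T$ is a real-valued stochastic process $X=\{X_t\}_{t\in T}$ with $\mathbb{P}(X_t\le x)=e^{-1/x}$ for all $t\in T$, $x>0$, such that for every $n\ge 1$ and independent copies $X^{(1)},\dots,X^{(n)}$ of $X$ the process $\{\max_{i\le n}X^{(i)}_t\}_{t\in T}$ has the same law as $\{nX_t\}_{t\in T}$. Its extremal coefficient function (ECF) is the function $\theta$ on the set of finite subsets of $T$ with values in $[0,\infty)$ given by $\theta(\varnothing)=0$ and $$\theta(A)=\lim_{x\to\infty}\frac{\log\mathbb{P}(\max_{s\in A}X_s\le x)}{\log\mathbb{P}(X_t\le x)}\qquad(A\neq\varnothing),$$ where $t\in T$ is arbitrary. Equip the power set $\mathcal{P}(T)$ with the topology of the Cantor cube $\{0,1\}^T$ via $Q\mapsto \mathbf{1}_Q$, and $\mathcal{P}(T)\setminus\{\varnothing\}$ with the subspace topology. A Radon measure is a measure on the Borel $\sigma$-algebra that is finite on compact sets and inner regular, that is, the measure of every Borel set is the supremum of the measures of its compact subsets. Let $\theta$ be the ECF of a simple max-stable process on $T$. Then $\theta(\{t\})=1$ for all $t\in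 T$, and there is a unique positive Radon measure $\mu$ on $\mathcal{P}(T)\setminus\{\varnothing\}$ such that for every finite $A\subseteq T$ $$\theta(A)=\mu\bigl(\{Q\in\mathcal{P}(T)\setminus\{\varnothing\} : A\cap Q\neq\varnothing\}\bigr)=\int_{\mathcal{P}(T)\setminus\{\varnothing\}}\mathbf{1}_{A\cap Q\neq\varnothing}\,\mu(dQ).$$ Moreover, $\theta$ is bounded if and only if $\mu(\mathcal{P}(T)\setminus\{\varnothing\})<\infty$. -/

import Mathlib

open MeasureTheory Filter Topology
open scoped NNReal ENNReal

universe u v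

/-- A simple max-stable process on `T`, defined on the probability space `(Ω, P)`:
each `X t` is a random variable with standard Fréchet law, and for every `n ≥ 1` the pointwise
maximum of `n` independent copies of `X` has the same law (on `T → ℝ` with the product
σ-algebra) as `n • X`. The independent copies are realised on the `n`-fold product of `(Ω, P)`,
the `i`-th copy being `ω ↦ X · (ω i)`; the law of the maximum does not depend on the choice of
the independent copies. -/
structure IsSimpleMaxStable {T : Type u} {Ω : Type v} [MeasurableSpace Ω] (P : Measure Ω)
    [IsProbabilityMeasure P] (X : T → Ω → ℝ) : Prop where
  measurable : ∀ t, Measurable (X t)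
  frechet : ∀ t, ∀ x : ℝ, 0 < x → P.real {ω | X t ω ≤ x} = Real.exp (-1 / x)
  maxStable : ∀ (n : ℕ) [NeZero n],
    (Measure.pi (fun _ : Fin n => P)).map
        (fun ω t => Finset.univ.sup' Finset.univ_nonempty (fun i : Fin n => X t (ω i))) =
      P.map (fun ω t => (n : ℝ) * X t ω)

/-- `θ` is the extremal coefficient function of the process `X`: `θ ∅ = 0`, and for nonempty
finite `A`, `θ A = lim_{x → ∞} log P(max_{s ∈ A} X s ≤ x) / log P(X t ≤ x)`
(all the `X t` have the same law, so `t` is immaterial). -/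
structure IsECFOf {T : Type u} {Ω : Type v} [MeasurableSpace Ω] (P : Measure Ω)
    (X : T → Ω → ℝ) (θ : Finset T → ℝ≥0) : Prop where
  empty : θ ∅ = 0
  tendsto : ∀ (A : Finset T) (hA : A.Nonempty) (t : T),
    Tendsto (fun x : ℝ =>
        Real.log (P.real {ω | A.sup' hA (fun s => X s ω) ≤ x}) /
          Real.log (P.real {ω | X t ω ≤ x}))
      atTop (𝓝 ((θ A : ℝ≥0) : ℝ))

/-- The set of extremal coefficient functions of simple max-stable processes on `T`
(on probability spaces in an arbitrary universe `v`). -/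
def ECFs (T : Type u) : Set (Finset T → ℝ≥0) :=
  {θ | ∃ (Ω : Type v) (_ : MeasurableSpace Ω) (P : Measure Ω) (_ : IsProbabilityMeasure P)
    (X : T → Ω → ℝ), IsSimpleMaxStable P X ∧ IsECFOf P X θ}

/-- The power set of `T` without the empty set. -/
def PuncturedPowerset (T : Type u) : Type u := {Q : Set T // Q ≠ ∅}

namespace PuncturedPowerset

/-- The subspace topology from the Cantor cube `{0,1}^T`, where `Q` is identified with its
indicator function `t ↦ 1_{t ∈ Q}`. -/
noncomputable instance (T : Type u) : TopologicalSpace (PuncturedPowerset T) :=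
  open scoped Classical in
  TopologicalSpace.induced (fun (Q : PuncturedPowerset T) (t : T) => (decide (t ∈ Q.1) : Bool))
    Pi.topologicalSpace

/-- The Borel σ-algebra (in general larger than the product σ-algebra when `T` is
uncountable). -/
noncomputable instance (T : Type u) : MeasurableSpace (PuncturedPowerset T) := borel _

instance (T : Type u) : BorelSpace (PuncturedPowerset T) := ⟨rfl⟩

/-- The family of all nonempty `Q ⊆ T` that meet `A`. -/
def hitting {T : Type u} (A : Finset T) : Set (PuncturedPowerset T) :=
  {Q | ((A : Set T) ∩ Q.1).Nonempty}

end PuncturedPowerset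

/-- Radon measures: Borel measures that are finite on compact sets and such that the measure of
every Borel set is the supremum of the measures of its compact subsets. -/
structure IsRadonMeasure {E : Type u} [TopologicalSpace E] [MeasurableSpace E] [BorelSpace E]
    (μ : Measure E) : Prop where
  lt_top_of_isCompact : ∀ K : Set E, IsCompact K → μ K < ∞
  inner_regular : ∀ B : Set E, MeasurableSet B →
    μ B = ⨆ (K : Set E) (_ : K ⊆ B) (_ : IsCompact K), μ K

/-!
The measure `μ` is the vague limit, as `x → ∞`, of `x · P(Q_x ∈ ·)`, where
`Q_x = {t | X t > x}` is the random exceedance set. Indeed `Q_x` meets `A` exactly when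
`max_{s ∈ A} X s > x`, and since `-log p ~ 1 - p` as `p → 1`, the logarithmic limit defining `θ A`
says that `x · P(max_{s ∈ A} X s > x) → θ A` (`IsECFOf.tendsto_mul_measure`). Only the Fréchet
margins enter here; max-stability plays no further role once the limit is known to exist.

Existence. Along a fixed ultrafilter `x · P(Q_x ∈ U)` converges for every `U`, and the limit is
finitely additive on the ring of compact open sets `U` that are measurable for the product
σ-algebra (`limitExceedance_union`); on `hitting A` it equals `θ A`. These sets separate compact
sets from closed ones, so the outer approximation of compact sets by members of the ring is a
content and yields a regular Borel measure extending the limit. When `T` is uncountable the space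
need not be σ-compact, and regularity in the sense of outer regularity does not give inner
regularity on Borel sets of infinite measure; passing to `s ↦ ⨆ K, μ (s ∩ K)` over compact `K` does
(`exists_isRadonMeasure_of_regular`).

Uniqueness. The values on the sets `hitting A` determine, by a π-system argument, a measure on the
ring; inner regularity of the complement of a compact set `K` in some `hitting A` approximates `K`
from outside by members of the ring, so they determine the measure on compact sets, and hence on
all Borel sets (`PuncturedPowerset.ext_of_hitting`). As every compact set lies in some `hitting A`,
the total mass is `⨆ A, θ A`, which gives the criterion for boundedness.
-/

/-! ### The topology of the punctured power set -/

namespace PuncturedPowerset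

variable {T : Type u}

/-- The inclusion of the nonempty subsets of `T` into `Set T`. The target carries the product
σ-algebra, while the source carries the (generally larger) Borel σ-algebra. -/
def toSet (Q : PuncturedPowerset T) : Set T := Q.1

lemma toSet_injective : Function.Injective (toSet (T := T)) := Subtype.val_injective

open scoped Classical in
/-- The indicator function of `Q`, as a point of the Cantor cube. -/
noncomputable def toCube (Q : PuncturedPowerset T) (t : T) : Bool := decide (t ∈ Q.1)

lemma toCube_eq_true {Q : PuncturedPowerset T} {t : T} : Q.toCube t = true ↔ t ∈ Q.toSet := by
  simp [toCube, toSet]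

lemma isInducing_toCube : IsInducing (toCube (T := T)) := ⟨rfl⟩

lemma toCube_injective : Function.Injective (toCube (T := T)) := fun Q R h ↦
  toSet_injective <| Set.ext fun t ↦ by rw [← toCube_eq_true, ← toCube_eq_true, h]

instance : T2Space (PuncturedPowerset T) :=
  T2Space.of_injective_continuous toCube_injective isInducing_toCube.continuous

lemma mem_hitting {A : Finset T} {Q : PuncturedPowerset T} :
    Q ∈ hitting A ↔ ∃ t ∈ A, t ∈ Q.toSet := by
  simp [hitting, toSet, Set.Nonempty]

@[simp] lemma hitting_empty : hitting (∅ : Finset T) = ∅ := by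
  ext Q; simp [mem_hitting]

lemma hitting_mono {A B : Finset T} (h : A ⊆ B) : hitting A ⊆ hitting B := fun Q hQ ↦ by
  obtain ⟨t, ht, htQ⟩ := mem_hitting.1 hQ
  exact mem_hitting.2 ⟨t, h ht, htQ⟩

lemma hitting_union [DecidableEq T] (A B : Finset T) :
    hitting (A ∪ B) = hitting A ∪ hitting B := by
  ext Q; simp [mem_hitting, or_and_right, exists_or]

lemma hitting_eq_biUnion (A : Finset T) : hitting A = ⋃ t ∈ A, {Q | t ∈ Q.toSet} := by
  ext Q; simp [mem_hitting]

lemma isClopen_setOf_mem (t : T) : IsClopen {Q : PuncturedPowerset T | t ∈ Q.toSet} := by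
  have : {Q : PuncturedPowerset T | t ∈ Q.toSet} = (fun Q ↦ Q.toCube t) ⁻¹' {true} := by
    ext Q; simp [toCube_eq_true]
  rw [this]
  exact (isClopen_discrete _).preimage ((continuous_apply t).comp isInducing_toCube.continuous)

lemma isClopen_hitting (A : Finset T) : IsClopen (hitting A) := by
  rw [hitting_eq_biUnion]
  exact A.finite_toSet.isClopen_biUnion fun t _ ↦ isClopen_setOf_mem t

/-- A set containing a fixed point `t` is automatically nonempty, so removing the empty set from
the Cantor cube does not affect the compactness of `{Q | t ∈ Q}`. -/
lemma isCompact_setOf_mem (t : T) : IsCompact {Q : PuncturedPowerset T | t ∈ Q.toSet} := by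
  rw [isInducing_toCube.isCompact_iff]
  have : toCube '' {Q : PuncturedPowerset T | t ∈ Q.toSet} = {f : T → Bool | f t = true} := by
    ext f
    constructor
    · rintro ⟨Q, hQ, rfl⟩
      exact toCube_eq_true.2 hQ
    · intro hf
      refine ⟨⟨{s | f s = true}, Set.Nonempty.ne_empty ⟨t, hf⟩⟩, hf, ?_⟩
      ext s
      simp [toCube]
  rw [this]
  exact (isClosed_eq (continuous_apply t) continuous_const).isCompact

lemma isCompact_hitting (A : Finset T) : IsCompact (hitting A) := by
  rw [hitting_eq_biUnion]
  exact A.finite_toSet.isCompact_biUnion fun t _ ↦ isCompact_setOf_mem t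

lemma nonempty_toSet (Q : PuncturedPowerset T) : Q.toSet.Nonempty :=
  Set.nonempty_iff_ne_empty.2 Q.2

instance : WeaklyLocallyCompactSpace (PuncturedPowerset T) where
  exists_compact_mem_nhds Q := by
    obtain ⟨t, ht⟩ := Q.nonempty_toSet
    exact ⟨_, isCompact_setOf_mem t, (isClopen_setOf_mem t).isOpen.mem_nhds ht⟩

/-- The ring of sets on which contents are prescribed: compact open families of subsets of `T`
that are measurable already for the product σ-algebra. (Every compact open family is in fact of
this kind.) Compactness is expressed by the containment in some `hitting A`. -/
structure IsCompactCylinder (U : Set (PuncturedPowerset T)) : Prop where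
  isClopen : IsClopen U
  measurableSet : MeasurableSet (toSet '' U)
  exists_subset_hitting : ∃ A : Finset T, U ⊆ hitting A

namespace IsCompactCylinder

variable {U V : Set (PuncturedPowerset T)}

protected lemma isCompact (hU : IsCompactCylinder U) : IsCompact U := by
  obtain ⟨A, hA⟩ := hU.exists_subset_hitting
  exact (isCompact_hitting A).of_isClosed_subset hU.isClopen.isClosed hA

protected lemma empty : IsCompactCylinder (∅ : Set (PuncturedPowerset T)) :=
  ⟨isClopen_empty, by simp, ∅, Set.empty_subset _⟩

protected lemma union (hU : IsCompactCylinder U) (hV : IsCompactCylinder V) :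
    IsCompactCylinder (U ∪ V) := by
  classical
  obtain ⟨A, hA⟩ := hU.exists_subset_hitting
  obtain ⟨B, hB⟩ := hV.exists_subset_hitting
  refine ⟨hU.isClopen.union hV.isClopen, ?_, A ∪ B, ?_⟩
  · rw [Set.image_union]
    exact hU.measurableSet.union hV.measurableSet
  · rw [hitting_union]
    exact Set.union_subset_union hA hB

protected lemma diff (hU : IsCompactCylinder U) (hV : IsCompactCylinder V) :
    IsCompactCylinder (U \ V) := by
  obtain ⟨A, hA⟩ := hU.exists_subset_hitting
  refine ⟨hU.isClopen.diff hV.isClopen, ?_, A, Set.sdiff_subset.trans hA⟩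
  rw [Set.image_sdiff toSet_injective]
  exact hU.measurableSet.diff hV.measurableSet

protected lemma inter (hU : IsCompactCylinder U) (hV : IsCompactCylinder V) :
    IsCompactCylinder (U ∩ V) := by
  rw [← Set.sdiff_sdiff_right_self]
  exact hU.diff (hU.diff hV)

protected lemma setOf_mem (t : T) :
    IsCompactCylinder {Q : PuncturedPowerset T | t ∈ Q.toSet} := by
  refine ⟨isClopen_setOf_mem t, ?_, {t}, fun Q hQ ↦ mem_hitting.2 ⟨t, by simp, hQ⟩⟩
  have : toSet '' {Q : PuncturedPowerset T | t ∈ Q.toSet} = {S | t ∈ S} := by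
    ext S
    constructor
    · rintro ⟨Q, hQ, rfl⟩
      exact hQ
    · intro hS
      exact ⟨⟨S, Set.Nonempty.ne_empty ⟨t, hS⟩⟩, hS, rfl⟩
  rw [this]
  exact measurableSet_setOfPred.2 (measurable_set_mem t)

protected lemma hitting (A : Finset T) : IsCompactCylinder (hitting A) := by
  classical
  induction A using Finset.induction_on with
  | empty => simpa using IsCompactCylinder.empty
  | insert t A _ ih =>
    have : PuncturedPowerset.hitting (insert t A) =
        {Q | t ∈ Q.toSet} ∪ PuncturedPowerset.hitting A := by
      ext Q; simp [mem_hitting]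
    rw [this]
    exact (IsCompactCylinder.setOf_mem t).union ih

end IsCompactCylinder

/-- Every neighbourhood of `Q` contains a set `{R | s ∈ R, R ∩ I = Q ∩ I}` with `s ∈ Q` and `I`
finite, and these are compact cylinders. -/
lemma exists_isCompactCylinder_subset {Q : PuncturedPowerset T} {O : Set (PuncturedPowerset T)}
    (hO : IsOpen O) (hQ : Q ∈ O) : ∃ V, IsCompactCylinder V ∧ Q ∈ V ∧ V ⊆ O := by
  classical
  obtain ⟨s, hs⟩ := Q.nonempty_toSet
  obtain ⟨W, hW, rfl⟩ := isInducing_toCube.isOpen_iff.1 hO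
  obtain ⟨I, u, hu, hIu⟩ := isOpen_pi_iff.1 hW _ hQ
  have key : ∀ J : Finset T, IsCompactCylinder
      {R : PuncturedPowerset T | s ∈ R.toSet ∧ ∀ t ∈ J, (t ∈ R.toSet ↔ t ∈ Q.toSet)} := by
    intro J
    induction J using Finset.induction_on with
    | empty => simpa using IsCompactCylinder.setOf_mem s
    | insert t J _ ih =>
      by_cases ht : t ∈ Q.toSet
      · convert ih.inter (IsCompactCylinder.setOf_mem t) using 1
        ext R
        simp [ht]
        tauto
      · convert ih.diff (IsCompactCylinder.setOf_mem t) using 1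
        ext R
        simp [ht]
        tauto
  refine ⟨_, key I, ⟨hs, fun t _ ↦ Iff.rfl⟩, fun R hR ↦ hIu fun t ht ↦ ?_⟩
  have : R.toCube t = Q.toCube t := by
    rw [Bool.eq_iff_iff, toCube_eq_true, toCube_eq_true]
    exact hR.2 t ht
  rw [this]
  exact (hu t ht).2

lemma exists_isCompactCylinder_between {K O : Set (PuncturedPowerset T)} (hK : IsCompact K)
    (hO : IsOpen O) (hKO : K ⊆ O) : ∃ V, IsCompactCylinder V ∧ K ⊆ V ∧ V ⊆ O := by
  refine hK.induction_on (p := fun S ↦ ∃ V, IsCompactCylinder V ∧ S ⊆ V ∧ V ⊆ O)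
    ⟨∅, .empty, subset_rfl, Set.empty_subset _⟩ ?_ ?_ ?_
  · rintro S S' hS ⟨V, hV, hSV, hVO⟩
    exact ⟨V, hV, hS.trans hSV, hVO⟩
  · rintro S S' ⟨V, hV, hSV, hVO⟩ ⟨V', hV', hSV', hVO'⟩
    exact ⟨V ∪ V', hV.union hV', Set.union_subset_union hSV hSV', Set.union_subset hVO hVO'⟩
  · intro Q hQ
    obtain ⟨V, hV, hQV, hVO⟩ := exists_isCompactCylinder_subset hO (hKO hQ)
    exact ⟨V, mem_nhdsWithin_of_mem_nhds (hV.isClopen.isOpen.mem_nhds hQV), V, hV, subset_rfl,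
      hVO⟩

lemma exists_subset_hitting {K : Set (PuncturedPowerset T)} (hK : IsCompact K) :
    ∃ A : Finset T, K ⊆ hitting A := by
  obtain ⟨V, hV, hKV, -⟩ := exists_isCompactCylinder_between hK isOpen_univ (Set.subset_univ K)
  obtain ⟨A, hA⟩ := hV.exists_subset_hitting
  exact ⟨A, hKV.trans hA⟩

end PuncturedPowerset

/-! ### From regular measures to Radon measures -/

/-- A regular measure on a space that is not σ-compact need not be inner regular on Borel sets of
infinite measure. Replacing `μ s` by `⨆ K, μ (s ∩ K)` over the compact sets `K` repairs this
without changing the measure of compact sets. -/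
theorem exists_isRadonMeasure_of_regular {E : Type u} [TopologicalSpace E] [T2Space E]
    [MeasurableSpace E] [BorelSpace E] (μ : Measure E) [μ.Regular] :
    ∃ ν : Measure E, IsRadonMeasure ν ∧ ∀ K, IsCompact K → ν K = μ K := by
  have hmono : ∀ s : Set E, Monotone fun K : TopologicalSpace.Compacts E ↦ μ (s ∩ K) :=
    fun s K L h ↦ measure_mono (Set.inter_subset_inter_right _ h)
  let ν : Measure E := Measure.ofMeasurable
    (fun s _ ↦ ⨆ K : TopologicalSpace.Compacts E, μ (s ∩ K)) (by simp) (by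
      intro f hf hd
      have h1 : ∀ K : TopologicalSpace.Compacts E,
          μ ((⋃ i, f i) ∩ K) = ∑' i, μ (f i ∩ K) := fun K ↦ by
        rw [Set.iUnion_inter, measure_iUnion]
        · exact fun i j hij ↦ (hd hij).mono Set.inter_subset_left Set.inter_subset_left
        · exact fun i ↦ (hf i).inter K.isCompact.measurableSet
      simp only [h1, ENNReal.tsum_eq_iSup_sum]
      rw [iSup_comm]
      congr! 2 with s
      exact (ENNReal.finsetSum_iSup_of_monotone fun i ↦ hmono (f i)).symm)
  have hν : ∀ s, MeasurableSet s → ν s = ⨆ K : TopologicalSpace.Compacts E, μ (s ∩ K) :=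
    fun s hs ↦ Measure.ofMeasurable_apply s hs
  have hνK : ∀ K, IsCompact K → ν K = μ K := fun K hK ↦ by
    rw [hν K hK.measurableSet]
    exact le_antisymm (iSup_le fun L ↦ measure_mono Set.inter_subset_left)
      (le_iSup_of_le ⟨K, hK⟩ (by simp))
  refine ⟨ν, ⟨fun K hK ↦ (hνK K hK).trans_lt hK.measure_lt_top, fun B hB ↦ ?_⟩, hνK⟩
  refine le_antisymm ?_ (iSup_le fun K ↦ iSup_le fun hK ↦ iSup_le fun _ ↦ measure_mono hK)
  rw [hν B hB]
  refine iSup_le fun L ↦ le_of_forall_lt fun r hr ↦ ?_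
  obtain ⟨K, hKB, hK, hrK⟩ := (hB.inter L.isCompact.measurableSet).exists_lt_isCompact_of_ne_top
    (measure_ne_top_of_subset Set.inter_subset_right L.isCompact.measure_ne_top) hr
  refine hrK.trans_le ?_
  rw [← hνK K hK]
  exact le_iSup_of_le K (le_iSup₂_of_le (hKB.trans Set.inter_subset_left) hK le_rfl)

namespace PuncturedPowerset

variable {T : Type u}

/-! ### Radon measures with prescribed values on compact cylinders -/

lemma mono_of_additive {m : Set (PuncturedPowerset T) → ℝ≥0∞}
    (hadd : ∀ U V, IsCompactCylinder U → IsCompactCylinder V → Disjoint U V →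
      m (U ∪ V) = m U + m V)
    {U V : Set (PuncturedPowerset T)} (hU : IsCompactCylinder U)
    (hV : IsCompactCylinder V) (h : U ⊆ V) : m U ≤ m V := by
  rw [← Set.union_sdiff_cancel h, hadd _ _ hU (hV.diff hU) Set.disjoint_sdiff_right]
  exact le_self_add

lemma union_le_of_additive {m : Set (PuncturedPowerset T) → ℝ≥0∞}
    (hadd : ∀ U V, IsCompactCylinder U → IsCompactCylinder V → Disjoint U V →
      m (U ∪ V) = m U + m V)
    {U V : Set (PuncturedPowerset T)} (hU : IsCompactCylinder U)
    (hV : IsCompactCylinder V) : m (U ∪ V) ≤ m U + m V := by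
  rw [← Set.union_sdiff_self, hadd _ _ hU (hV.diff hU) Set.disjoint_sdiff_right]
  gcongr
  exact mono_of_additive hadd (hV.diff hU) hV Set.sdiff_subset

/-- The outer approximation of a set `K` by compact cylinders, with respect to a set function
`m`. -/
noncomputable def outerContent (m : Set (PuncturedPowerset T) → ℝ≥0∞)
    (K : Set (PuncturedPowerset T)) : ℝ≥0∞ :=
  ⨅ (U) (_ : IsCompactCylinder U) (_ : K ⊆ U), m U

/-- A finitely additive set function on compact cylinders, finite on each `hitting A`, is the
restriction of a Radon measure. The outer approximation of compact sets by compact cylinders is a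
content; its regular measure is then made inner regular on all Borel sets. -/
theorem exists_isRadonMeasure_of_additive (m : Set (PuncturedPowerset T) → ℝ≥0∞)
    (hfin : ∀ A, m (hitting A) ≠ ∞)
    (hadd : ∀ U V, IsCompactCylinder U → IsCompactCylinder V → Disjoint U V →
      m (U ∪ V) = m U + m V) :
    ∃ μ : Measure (PuncturedPowerset T), IsRadonMeasure μ ∧
      ∀ U, IsCompactCylinder U → μ U = m U := by
  have hle : ∀ {K U}, IsCompactCylinder U → K ⊆ U → outerContent m K ≤ m U :=
    fun hU h ↦ iInf_le_of_le _ (iInf₂_le_of_le hU h le_rfl)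
  have hmono : ∀ {K L}, K ⊆ L → outerContent m K ≤ outerContent m L := fun h ↦
    le_iInf fun U ↦ le_iInf fun hU ↦ le_iInf fun hLU ↦ hle hU (h.trans hLU)
  have heq : ∀ {U}, IsCompactCylinder U → outerContent m U = m U := fun hU ↦
    le_antisymm (hle hU subset_rfl) <| le_iInf fun V ↦ le_iInf fun hV ↦ le_iInf fun h ↦
      mono_of_additive hadd hU hV h
  have hK : ∀ K : TopologicalSpace.Compacts (PuncturedPowerset T), outerContent m K ≠ ∞ := by
    intro K
    obtain ⟨A, hA⟩ := exists_subset_hitting K.isCompact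
    exact ne_top_of_le_ne_top (hfin A) (hle (.hitting A) hA)
  have hunion : ∀ K L, outerContent m (K ∪ L) ≤ outerContent m K + outerContent m L := by
    intro K L
    rw [outerContent.eq_1 m K, outerContent.eq_1 m L]
    simp only [ENNReal.iInf_add, ENNReal.add_iInf]
    refine le_iInf fun V ↦ le_iInf fun hV ↦ le_iInf fun hLV ↦ le_iInf fun U ↦ le_iInf fun hU ↦
      le_iInf fun hKU ↦ ?_
    exact (hle (hU.union hV) (Set.union_subset_union hKU hLV)).trans
      (union_le_of_additive hadd hU hV)
  let c : Content (PuncturedPowerset T) :=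
    { toFun := fun K ↦ (outerContent m K).toNNReal
      mono' := fun K L h ↦ ENNReal.toNNReal_mono (hK L) (hmono h)
      sup_le' := fun K L ↦ by
        rw [← ENNReal.toNNReal_add (hK K) (hK L)]
        exact ENNReal.toNNReal_mono (ENNReal.add_ne_top.2 ⟨hK K, hK L⟩) (hunion K L)
      sup_disjoint' := fun K L hKL _ hL ↦ by
        rw [← ENNReal.toNNReal_add (hK K) (hK L)]
        congr 1
        refine le_antisymm (hunion K L) ?_
        refine le_iInf fun U ↦ le_iInf fun hU ↦ le_iInf fun hKLU ↦ ?_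
        -- A cylinder `V` separating `K` from `L` splits `U` into neighbourhoods of `K` and `L`.
        obtain ⟨V, hV, hKV, hVL⟩ := exists_isCompactCylinder_between K.isCompact hL.isOpen_compl
          hKL.subset_compl_right
        have hKLU' : (K : Set (PuncturedPowerset T)) ∪ L ⊆ U := hKLU
        rw [← Set.inter_union_sdiff U V, hadd _ _ (hU.inter hV) (hU.diff hV)
          (Set.disjoint_sdiff_inter.symm)]
        refine add_le_add (hle (hU.inter hV) ?_) (hle (hU.diff hV) ?_)
        · exact Set.subset_inter (Set.subset_union_left.trans hKLU') hKV
        · exact fun Q hQ ↦ ⟨hKLU' (Or.inr hQ), fun h ↦ hVL h hQ⟩ }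
  obtain ⟨μ, hμ, hμc⟩ := exists_isRadonMeasure_of_regular c.measure
  refine ⟨μ, hμ, fun U hU ↦ ?_⟩
  rw [hμc _ hU.isCompact, c.measure_apply hU.isClopen.isOpen.measurableSet,
    c.outerMeasure_of_isOpen _ hU.isClopen.isOpen, c.innerContent_of_isCompact hU.isCompact]
  exact (ENNReal.coe_toNNReal (hK ⟨U, hU.isCompact⟩)).trans (heq hU)

/-! ### Uniqueness -/

lemma measurable_toSet : Measurable (toSet (T := T)) :=
  measurable_set_iff.2 fun t ↦ measurableSet_setOfPred.1 (isClopen_setOf_mem t).isOpen.measurableSet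

lemma measurableSet_disjoint_finset (B : Finset T) :
    MeasurableSet {S : Set T | Disjoint (B : Set T) S} := by
  have : {S : Set T | Disjoint (B : Set T) S} = ⋂ t ∈ B, {S | t ∉ S} := by
    ext S; simp [Set.disjoint_left]
  rw [this]
  exact B.measurableSet_biInter fun t _ ↦ measurableSet_setOfPred.2 (measurable_set_notMem t)

lemma isPiSystem_disjoint_finset :
    IsPiSystem (Set.range fun B : Finset T ↦ {S : Set T | Disjoint (B : Set T) S}) := by
  classical
  rintro _ ⟨B, rfl⟩ _ ⟨C, rfl⟩ -
  exact ⟨B ∪ C, by ext S; simp [Set.disjoint_union_left]⟩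

lemma generateFrom_disjoint_finset :
    (inferInstance : MeasurableSpace (Set T)) = MeasurableSpace.generateFrom
      (Set.range fun B : Finset T ↦ {S : Set T | Disjoint (B : Set T) S}) := by
  apply le_antisymm
  · have : Measurable[MeasurableSpace.generateFrom
        (Set.range fun B : Finset T ↦ {S : Set T | Disjoint (B : Set T) S})]
        (fun S : Set T ↦ S) := by
      let _ := MeasurableSpace.generateFrom
        (Set.range fun B : Finset T ↦ {S : Set T | Disjoint (B : Set T) S})
      refine measurable_set_iff.2 fun t ↦ measurableSet_setOfPred.1 ?_
      have h : MeasurableSet {S : Set T | Disjoint (({t} : Finset T) : Set T) S} :=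
        MeasurableSpace.measurableSet_generateFrom ⟨{t}, rfl⟩
      convert h.compl using 1
      ext S
      simp
    intro s hs
    exact this hs
  · refine MeasurableSpace.generateFrom_le ?_
    rintro _ ⟨B, rfl⟩
    exact measurableSet_disjoint_finset B

variable {μ ν : Measure (PuncturedPowerset T)}

/-- On compact cylinders a measure is determined by its values on the sets `hitting A`: the sets
missing a finite set `B` form a π-system generating the product σ-algebra, and their traces on
`hitting A` have measure `μ (hitting (A ∪ B)) - μ (hitting B)`. -/
lemma measure_eq_of_isCompactCylinder (hfin : ∀ A : Finset T, μ (hitting A) ≠ ∞)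
    (h : ∀ A : Finset T, μ (hitting A) = ν (hitting A)) {U : Set (PuncturedPowerset T)}
    (hU : IsCompactCylinder U) : μ U = ν U := by
  classical
  obtain ⟨A, hA⟩ := hU.exists_subset_hitting
  have hmeas : ∀ B : Finset T, MeasurableSet (hitting B) :=
    fun B ↦ (isClopen_hitting B).isOpen.measurableSet
  have hmiss : ∀ B : Finset T, toSet ⁻¹' {S : Set T | Disjoint (B : Set T) S} ∩ hitting A =
      hitting (A ∪ B) \ hitting B := by
    intro B
    have : toSet ⁻¹' {S : Set T | Disjoint (B : Set T) S} = (hitting B)ᶜ := by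
      ext Q; simp [mem_hitting, Set.disjoint_left]
    rw [this, hitting_union, Set.union_sdiff_right, Set.inter_comm]
    rfl
  have hsub : ∀ B : Finset T, hitting B ⊆ hitting (A ∪ B) :=
    fun B ↦ hitting_mono Finset.subset_union_right
  have : IsFiniteMeasure ((μ.restrict (hitting A)).map toSet) := by
    have : IsFiniteMeasure (μ.restrict (hitting A)) :=
      ⟨by simpa using (hfin A).lt_top⟩
    infer_instance
  have key : (μ.restrict (hitting A)).map toSet = (ν.restrict (hitting A)).map toSet := by
    refine ext_of_generate_finite _ generateFrom_disjoint_finset isPiSystem_disjoint_finset ?_ ?_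
    · rintro _ ⟨B, rfl⟩
      rw [Measure.map_apply measurable_toSet (measurableSet_disjoint_finset B),
        Measure.map_apply measurable_toSet (measurableSet_disjoint_finset B),
        Measure.restrict_apply (measurable_toSet (measurableSet_disjoint_finset B)),
        Measure.restrict_apply (measurable_toSet (measurableSet_disjoint_finset B)), hmiss,
        measure_sdiff (hsub B) (hmeas B).nullMeasurableSet (hfin B),
        measure_sdiff (hsub B) (hmeas B).nullMeasurableSet (h B ▸ hfin B), h, h]
    · simp [Measure.map_apply measurable_toSet MeasurableSet.univ, h]
  have := congrArg (fun ρ ↦ ρ (toSet '' U)) key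
  simp only [Measure.map_apply measurable_toSet hU.measurableSet,
    Set.preimage_image_eq _ toSet_injective,
    Measure.restrict_apply hU.isClopen.isOpen.measurableSet,
    Set.inter_eq_left.2 hA] at this
  exact this

/-- Agreement on compact cylinders passes to compact sets: a compact `K ⊆ hitting A` is approximated
from outside by compact cylinders, because `hitting A \ K` is approximated from inside by compact
sets. -/
lemma measure_isCompact_le (hμ : ∀ U, IsCompactCylinder U → μ U = ν U) (hν : IsRadonMeasure ν)
    {K : Set (PuncturedPowerset T)} (hK : IsCompact K) : μ K ≤ ν K := by
  obtain ⟨A, hKA⟩ := exists_subset_hitting hK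
  have hA : ν (hitting A) ≠ ∞ := (hν.lt_top_of_isCompact _ (isCompact_hitting A)).ne
  have hle : ν (hitting A \ K) + μ K ≤ ν (hitting A) := by
    have hKA' : μ K ≤ ν (hitting A) := hμ _ (.hitting A) ▸ measure_mono hKA
    refine add_le_of_le_tsub_right_of_le hKA' ?_
    rw [hν.inner_regular _ ((isClopen_hitting A).isOpen.measurableSet.diff hK.measurableSet)]
    refine iSup_le fun L ↦ iSup_le fun hLA ↦ iSup_le fun hL ↦
      ENNReal.le_sub_of_add_le_right (ne_top_of_le_ne_top hA hKA') ?_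
    obtain ⟨V, hV, hKV, hVL⟩ := exists_isCompactCylinder_between hK
      ((isClopen_hitting A).isOpen.sdiff hL.isClosed) fun Q hQ ↦ ⟨hKA hQ, fun h ↦ (hLA h).2 hQ⟩
    calc ν L + μ K ≤ ν L + ν V := add_le_add le_rfl ((measure_mono hKV).trans (hμ V hV).le)
      _ = ν (L ∪ V) := (measure_union (Set.disjoint_right.2 fun Q hQ ↦ (hVL hQ).2)
          hV.isClopen.isOpen.measurableSet).symm
      _ ≤ ν (hitting A) := measure_mono (Set.union_subset (hLA.trans Set.sdiff_subset)
          (hVL.trans Set.sdiff_subset))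
  rw [← measure_sdiff_add_inter (hitting A) hK.measurableSet, Set.inter_eq_right.2 hKA] at hle
  exact (ENNReal.add_le_add_iff_left
    (measure_ne_top_of_subset Set.sdiff_subset hA)).1 hle

/-- Two Radon measures with the same values on all sets `hitting A` are equal. -/
theorem ext_of_hitting (hμ : IsRadonMeasure μ) (hν : IsRadonMeasure ν)
    (h : ∀ A : Finset T, μ (hitting A) = ν (hitting A)) : μ = ν := by
  have hfin : ∀ A : Finset T, μ (hitting A) ≠ ∞ :=
    fun A ↦ (hμ.lt_top_of_isCompact _ (isCompact_hitting A)).ne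
  have hcyl : ∀ U, IsCompactCylinder U → μ U = ν U :=
    fun U hU ↦ measure_eq_of_isCompactCylinder hfin h hU
  refine Measure.ext fun B hB ↦ ?_
  rw [hμ.inner_regular B hB, hν.inner_regular B hB]
  congr! 4 with K _ hK
  exact le_antisymm (measure_isCompact_le hcyl hν hK)
    (measure_isCompact_le (fun U hU ↦ (hcyl U hU).symm) hμ hK)

end PuncturedPowerset

/-! ### Tails of simple max-stable processes -/

lemma compl_setOf_sup'_le {T : Type u} {Ω : Type v} {X : T → Ω → ℝ} {A : Finset T} (hA : A.Nonempty)
    (x : ℝ) :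
    {ω | A.sup' hA (fun s ↦ X s ω) ≤ x}ᶜ = {ω | ∃ t ∈ A, x < X t ω} := by
  ext ω; simp

section Exceedance

variable {T : Type u} {Ω : Type v} [MeasurableSpace Ω] {P : Measure Ω} [IsProbabilityMeasure P]
  {X : T → Ω → ℝ} {θ : Finset T → ℝ≥0}

namespace IsSimpleMaxStable

lemma log_real_le (hX : IsSimpleMaxStable P X) (t : T) {x : ℝ} (hx : 0 < x) :
    Real.log (P.real {ω | X t ω ≤ x}) = -1 / x := by
  rw [hX.frechet t x hx, Real.log_exp]

lemma measurableSet_sup'_le (hX : IsSimpleMaxStable P X) {A : Finset T} (hA : A.Nonempty)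
    (x : ℝ) : MeasurableSet {ω | A.sup' hA (fun s ↦ X s ω) ≤ x} := by
  simp only [Finset.sup'_le_iff, Set.ofPred_forall]
  exact A.measurableSet_biInter fun t _ ↦ measurableSet_le (hX.measurable t) measurable_const

lemma one_sub_real_sup'_le_le (hX : IsSimpleMaxStable P X) {A : Finset T} (hA : A.Nonempty)
    {x : ℝ} (hx : 0 < x) :
    1 - P.real {ω | A.sup' hA (fun s ↦ X s ω) ≤ x} ≤ A.card * x⁻¹ := by
  rw [← probReal_compl_eq_one_sub (hX.measurableSet_sup'_le hA x), compl_setOf_sup'_le]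
  have : {ω | ∃ t ∈ A, x < X t ω} = ⋃ t ∈ A, {ω | X t ω ≤ x}ᶜ := by ext ω; simp
  rw [this]
  refine (measureReal_biUnion_finset_le _ _).trans ?_
  rw [← nsmul_eq_mul]
  refine Finset.sum_le_card_nsmul _ _ _ fun t _ ↦ ?_
  rw [probReal_compl_eq_one_sub (measurableSet_le (hX.measurable t) measurable_const),
    hX.frechet t x hx]
  have := Real.add_one_le_exp (-1 / x)
  rw [neg_div, one_div] at this ⊢
  linarith

lemma tendsto_real_sup'_le (hX : IsSimpleMaxStable P X) {A : Finset T} (hA : A.Nonempty) :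
    Tendsto (fun x : ℝ ↦ P.real {ω | A.sup' hA (fun s ↦ X s ω) ≤ x}) atTop (𝓝 1) := by
  have h : Tendsto (fun x : ℝ ↦ 1 - A.card * x⁻¹) atTop (𝓝 1) := by
    simpa using (tendsto_inv_atTop_zero.const_mul (A.card : ℝ)).const_sub 1
  refine tendsto_of_tendsto_of_tendsto_of_le_of_le' h tendsto_const_nhds ?_ ?_
  · filter_upwards [eventually_gt_atTop 0] with x hx
    linarith [hX.one_sub_real_sup'_le_le hA hx]
  · exact .of_forall fun x ↦ measureReal_le_one

end IsSimpleMaxStable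

lemma IsECFOf.singleton (hX : IsSimpleMaxStable P X) (hθ : IsECFOf P X θ) (t : T) :
    θ {t} = 1 := by
  have h := hθ.tendsto {t} (Finset.singleton_nonempty t) t
  have h1 : Tendsto (fun _ : ℝ ↦ (1 : ℝ)) atTop (𝓝 ((θ {t} : ℝ≥0) : ℝ)) := by
    refine h.congr' ?_
    filter_upwards [eventually_gt_atTop 0] with x hx
    simp only [Finset.sup'_singleton]
    rw [hX.log_real_le t hx, div_self]
    exact (div_neg_of_neg_of_pos (by norm_num) hx).ne
  exact_mod_cast tendsto_nhds_unique h1 tendsto_const_nhds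

/-- As `-log p ~ 1 - p` for `p → 1`, the logarithmic tails in the definition of the extremal
coefficient function may be replaced by the tails themselves. -/
lemma IsECFOf.tendsto_mul_measure (hX : IsSimpleMaxStable P X) (hθ : IsECFOf P X θ)
    (A : Finset T) :
    Tendsto (fun x : ℝ ↦ ENNReal.ofReal x * P {ω | ∃ t ∈ A, x < X t ω}) atTop
      (𝓝 (θ A : ℝ≥0∞)) := by
  rcases A.eq_empty_or_nonempty with rfl | hA
  · simp [hθ.empty]
  obtain ⟨t, ht⟩ := hA
  have hA : A.Nonempty := ⟨t, ht⟩
  set p : ℝ → ℝ := fun x ↦ P.real {ω | A.sup' hA (fun s ↦ X s ω) ≤ x} with hp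
  have hp1 : Tendsto p atTop (𝓝 1) := hX.tendsto_real_sup'_le hA
  have hlog : Tendsto (fun x ↦ x * -Real.log (p x)) atTop (𝓝 (θ A : ℝ)) := by
    refine (hθ.tendsto A hA t).congr' ?_
    filter_upwards [eventually_gt_atTop 0] with x hx
    rw [hX.log_real_le t hx]
    field_simp
    rfl
  have hpos : ∀ᶠ x in atTop, 0 < p x := hp1.eventually (lt_mem_nhds one_pos)
  have hreal : Tendsto (fun x ↦ x * (1 - p x)) atTop (𝓝 (θ A : ℝ)) := by
    have hlow : Tendsto (fun x ↦ p x * (x * -Real.log (p x))) atTop (𝓝 (θ A : ℝ)) := by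
      simpa using hp1.mul hlog
    refine tendsto_of_tendsto_of_tendsto_of_le_of_le' hlow hlog ?_ ?_
    · filter_upwards [eventually_gt_atTop 0, hpos] with x hx hpx
      have h1 := mul_le_mul_of_nonneg_left (Real.one_sub_inv_le_log_of_pos hpx) hpx.le
      rw [mul_sub, mul_inv_cancel₀ hpx.ne'] at h1
      have h2 := mul_le_mul_of_nonneg_left h1 hx.le
      linarith
    · filter_upwards [eventually_gt_atTop 0, hpos] with x hx hpx
      have h1 := Real.log_le_sub_one_of_pos hpx
      gcongr
      linarith
  have := ENNReal.tendsto_ofReal hreal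
  rw [ENNReal.ofReal_coe_nnreal] at this
  refine this.congr' ?_
  filter_upwards [eventually_ge_atTop 0] with x hx
  rw [ENNReal.ofReal_mul hx, ← compl_setOf_sup'_le hA,
    ← probReal_compl_eq_one_sub (hX.measurableSet_sup'_le hA x), ofReal_measureReal]

/-! ### The spectral measure -/

/-- The rescaled probability, at level `x`, that the exceedance set `{t | x < X t}` belongs to
`U`. -/
noncomputable def exceedance (P : Measure Ω) (X : T → Ω → ℝ) (x : ℝ)
    (U : Set (PuncturedPowerset T)) : ℝ≥0∞ :=
  ENNReal.ofReal x * P {ω | {t | x < X t ω} ∈ PuncturedPowerset.toSet '' U}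

/-- A limit of `exceedance P X x` as `x → ∞`, taken along a fixed ultrafilter so that it exists
without further argument. -/
noncomputable def limitExceedance (P : Measure Ω) (X : T → Ω → ℝ)
    (U : Set (PuncturedPowerset T)) : ℝ≥0∞ :=
  limUnder (Ultrafilter.of (atTop : Filter ℝ) : Filter ℝ) (exceedance P X · U)

lemma tendsto_exceedance (P : Measure Ω) (X : T → Ω → ℝ) (U : Set (PuncturedPowerset T)) :
    Tendsto (exceedance P X · U) (Ultrafilter.of (atTop : Filter ℝ) : Filter ℝ)
      (𝓝 (limitExceedance P X U)) :=
  ((Ultrafilter.of (atTop : Filter ℝ)).map (exceedance P X · U)).le_nhds_lim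

lemma limitExceedance_union (hX : IsSimpleMaxStable P X) {U V : Set (PuncturedPowerset T)}
    (hV : PuncturedPowerset.IsCompactCylinder V) (hUV : Disjoint U V) :
    limitExceedance P X (U ∪ V) = limitExceedance P X U + limitExceedance P X V := by
  refine tendsto_nhds_unique (tendsto_exceedance P X _) ?_
  refine ((tendsto_exceedance P X U).add (tendsto_exceedance P X V)).congr fun x ↦ ?_
  have hmeas : Measurable fun ω ↦ {t | x < X t ω} :=
    measurable_set_iff.2 fun t ↦ measurableSet_setOfPred.1
      (measurableSet_lt measurable_const (hX.measurable t))
  rw [exceedance, exceedance, exceedance, ← mul_add, Set.image_union]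
  congr 1
  exact (measure_union ((Set.disjoint_image_iff PuncturedPowerset.toSet_injective).2 hUV
    |>.preimage _) (hmeas hV.measurableSet)).symm

lemma limitExceedance_hitting (hX : IsSimpleMaxStable P X) (hθ : IsECFOf P X θ) (A : Finset T) :
    limitExceedance P X (PuncturedPowerset.hitting A) = θ A := by
  refine tendsto_nhds_unique (tendsto_exceedance P X _) ?_
  refine ((hθ.tendsto_mul_measure hX A).mono_left (Ultrafilter.of_le _)).congr fun x ↦ ?_
  rw [exceedance]
  congr 2
  ext ω
  constructor
  · rintro ⟨t, htA, ht⟩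
    exact ⟨⟨{t | x < X t ω}, Set.Nonempty.ne_empty ⟨t, ht⟩⟩,
      PuncturedPowerset.mem_hitting.2 ⟨t, htA, ht⟩, rfl⟩
  · rintro ⟨Q, hQ, hQω⟩
    obtain ⟨t, htA, ht⟩ := PuncturedPowerset.mem_hitting.1 hQ
    rw [hQω] at ht
    exact ⟨t, htA, ht⟩

end Exceedance

open PuncturedPowerset in
/-- The total mass is approached along compact sets, hence along the sets `hitting A`. -/
lemma PuncturedPowerset.bddAbove_range_iff {T : Type u} {θ : Finset T → ℝ≥0}
    {μ : Measure (PuncturedPowerset T)} (hμ : IsRadonMeasure μ)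
    (h : ∀ A : Finset T, (θ A : ℝ≥0∞) = μ (hitting A)) :
    BddAbove (Set.range θ) ↔ μ Set.univ < ∞ := by
  constructor
  · rintro ⟨C, hC⟩
    refine lt_of_le_of_lt ?_ (ENNReal.coe_lt_top (r := C))
    rw [hμ.inner_regular _ MeasurableSet.univ]
    refine iSup_le fun K ↦ iSup_le fun _ ↦ iSup_le fun hK ↦ ?_
    obtain ⟨A, hA⟩ := exists_subset_hitting hK
    refine (measure_mono hA).trans ?_
    rw [← h A]
    exact_mod_cast hC ⟨A, rfl⟩
  · intro hfin
    refine ⟨(μ Set.univ).toNNReal, ?_⟩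
    rintro _ ⟨A, rfl⟩
    rw [← ENNReal.coe_le_coe, ENNReal.coe_toNNReal hfin.ne, h]
    exact measure_mono (Set.subset_univ _)

theorem corollary3 {T : Type u} (θ : Finset T → ℝ≥0) (hθ : θ ∈ ECFs.{u, v} T) :
    (∀ t : T, θ {t} = 1) ∧
    ∃ μ : Measure (PuncturedPowerset T),
      IsRadonMeasure μ ∧
      (∀ A : Finset T, (θ A : ℝ≥0∞) = μ (PuncturedPowerset.hitting A)) ∧
      (∀ A : Finset T, (θ A : ℝ≥0∞) =
        ∫⁻ Q, (PuncturedPowerset.hitting A).indicator (fun _ => 1) Q ∂μ) ∧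
      (∀ ν : Measure (PuncturedPowerset T), IsRadonMeasure ν →
        (∀ A : Finset T, (θ A : ℝ≥0∞) = ν (PuncturedPowerset.hitting A)) → ν = μ) ∧
      (BddAbove (Set.range θ) ↔ μ Set.univ < ∞) := by
  obtain ⟨Ω, _, P, _, X, hX, hθ⟩ := hθ
  obtain ⟨μ, hμ, hμU⟩ := PuncturedPowerset.exists_isRadonMeasure_of_additive
    (limitExceedance P X) (fun A ↦ by simp [limitExceedance_hitting hX hθ])
    (fun U V _ hV hUV ↦ limitExceedance_union hX hV hUV)
  have hμA : ∀ A : Finset T, (θ A : ℝ≥0∞) = μ (PuncturedPowerset.hitting A) := fun A ↦ by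
    rw [hμU _ (.hitting A), limitExceedance_hitting hX hθ]
  refine ⟨hθ.singleton hX, μ, hμ, hμA, fun A ↦ ?_, fun ν hν hνA ↦ ?_,
    PuncturedPowerset.bddAbove_range_iff hμ hμA⟩
  · rw [lintegral_indicator_const (PuncturedPowerset.isClopen_hitting A).isOpen.measurableSet,
      one_mul, hμA]
  · exact PuncturedPowerset.ext_of_hitting hν hμ fun A ↦ by rw [← hνA, hμA]
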